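/- All groups are abelian. A torsion-free group $G$ of finite rank is *almost completely decomposable* if it has a completely decomposable subgroup (a direct sum of torsion-free groups of rank $1$) of finite index. Its *regulator* $A=\mathrm{Reg}\,G$ is the intersection of all completely decomposable subgroups of least index; it is completely decomposable. Fix a decomposition of $A$ into a direct sum of groups of rank $1$. For a type $\tau$ let $A_\tau=\mathrm{Reg}_\tau G$ be the sum of the summands of type $\tau$ in this decomposition, and let $T=T(G)=\{\tau : A_\tau\neq 0\}$, so that $A=\bigoplus_{\tau\in T}A_\tau$. The group $G$ is *rigid* if the types in $T$ are pairwise non-comparable and each $A_\tau$ ($\tau\in T$) has rank $1$; it is *of ring type* if all types in $T$ are idempotent. Let $G$ be a rigid almost completely decomposable group of ring type whose regulator quotient $G/A$ is cyclic, say $G/A=\langle d+A\rangle$ with $d\in G$. The divisible hull of $G$ is $\tilde G=\bigoplus_{\tau\in T}\tilde A_\tau$, where $\tilde A_\tau$ is the divisible hull of $A_\tau$; let $\pi_\tau\colon\tilde G\to\tilde A_\tau$ be the projections. For $\tau\in T$ let $m_\tau$ be the order of $\pi_\tau(d)+A$ in the torsion group $\tilde G/A$, and let $R_\tau$ be the unital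 subring of $\mathbb{Q}$ whose additive group has type $\tau$. Put $T_0=\{\tau\in T : m_\tau>1\}$, let $1_{T_0}\in\prod_{\tau\in T}R_\tau$ be the element with components $1$ for $\tau\in T_0$ and $0$ for $\tau\in T\setminus T_0$, and let $$K_G=\mathbb{Z}\,1_{T_0}+\prod_{\tau\in T}m_\tau R_\tau ,$$ a unital subring of $\prod_{\tau\in T}R_\tau$ with group of units $K_G^*$. For $c=(c_\tau)_{\tau\in T}\in\prod_{\tau\in T}R_\tau$ and $x\in\tilde G$ put $cx=\sum_{\tau\in T}c_\tau\,\pi_\tau(x)$. **Lemma 2.3.** (1) If $f$ is an endomorphism (resp., an automorphism) of the group $G$, then there is an element $c\in K_G$ (resp., $c\in K_G^*$) such that $f(x)=cx$ for all $x\in G$. (2) If $c\in K_G$ (resp., $c\in K_G^*$), then there is an endomorphism (resp., an automorphism) $f\colon G\to G$ such that $f(x)=cx$ for all $x\in G$. -/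

import Mathlib

noncomputable section

namespace ACD

/-! ### Heights, characteristics, types -/

/-- The `p`-height of `x` in the abelian group `B`: the supremum of all `k` with `x ∈ p ^ k B`. -/
def height {B : Type*} [AddCommGroup B] (p : Nat.Primes) (x : B) : ℕ∞ :=
  ⨆ (k : ℕ) (_ : ∃ y : B, ((p : ℕ) ^ k) • y = x), (k : ℕ∞)

/-- A (possible) characteristic: a family of elements of `ℕ ∪ {∞}` indexed by the primes. -/
abbrev Characteristic := Nat.Primes → ℕ∞

/-- The characteristic `χ(x)` of an element of an abelian group. -/
def characteristic {B : Type*} [AddCommGroup B] (x : B) : Characteristic := fun p => height p x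

/-- Two characteristics are equivalent if they differ at finitely many primes only, and have the
value `∞` at the same primes. -/
instance typeSetoid : Setoid Characteristic where
  r χ ψ := {p | χ p ≠ ψ p}.Finite ∧ ∀ p, χ p = ⊤ ↔ ψ p = ⊤
  iseqv :=
    { refl := fun χ => by simp
      symm := fun {χ ψ} h => by
        refine ⟨?_, fun p => (h.2 p).symm⟩
        simpa only [ne_comm] using h.1
      trans := fun {χ ψ ω} h g => by
        refine ⟨(h.1.union g.1).subset ?_, fun p => (h.2 p).trans (g.2 p)⟩
        intro p hp
        by_contra hc
        simp only [Set.mem_union, Set.mem_ofPred_eq, not_or, not_not] at hc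
        exact hp (hc.1.trans hc.2) }

/-- A type is an equivalence class of characteristics. -/
def GroupType := Quotient typeSetoid

/-- The type of a characteristic. -/
def GroupType.mk (χ : Characteristic) : GroupType := Quotient.mk typeSetoid χ

/-- The pointwise order of characteristics induces the order of types. -/
instance : LE GroupType where
  le τ σ := ∃ χ ψ : Characteristic, GroupType.mk χ = τ ∧ GroupType.mk ψ = σ ∧ χ ≤ ψ

/-- A type is idempotent if it contains a characteristic with values in `{0, ∞}`. -/
def GroupType.IsIdempotent (τ : GroupType) : Prop :=
  ∃ χ : Characteristic, GroupType.mk χ = τ ∧ ∀ p, χ p = 0 ∨ χ p = ⊤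

/-- The type of an element of an abelian group. -/
def elemType {B : Type*} [AddCommGroup B] (x : B) : GroupType := GroupType.mk (characteristic x)

/-- Torsion-free groups of rank `1`. -/
def IsRankOne (B : Type*) [AddCommGroup B] : Prop :=
  IsAddTorsionFree B ∧ Module.rank ℤ B = 1

/-- `B` is a torsion-free group of rank `1` and of type `τ`, i.e. all its nonzero elements have
type `τ`. -/
def HasType (B : Type*) [AddCommGroup B] (τ : GroupType) : Prop :=
  IsRankOne B ∧ ∀ x : B, x ≠ 0 → elemType x = τ

/-! ### Almost completely decomposable groups and the regulator -/

/-- The family `B` of subgroups consists of torsion-free groups of rank `1`, and the subgroup `A`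
is the (internal) direct sum of this family. -/
structure IsRankOneDecomposition {G : Type*} [AddCommGroup G] {n : ℕ} (B : Fin n → AddSubgroup G)
    (A : AddSubgroup G) : Prop where
  rankOne : ∀ i, IsRankOne (B i)
  indep : iSupIndep B
  iSup_eq : ⨆ i, B i = A

/-- The subgroup `A` is a completely decomposable group of finite rank. -/
def IsCompletelyDecomposable {G : Type*} [AddCommGroup G] (A : AddSubgroup G) : Prop :=
  ∃ (n : ℕ) (B : Fin n → AddSubgroup G), IsRankOneDecomposition B A

/-- `G` is an almost completely decomposable group: a torsion-free group of finite rank with a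
completely decomposable subgroup of finite index. -/
class IsAlmostCompletelyDecomposable (G : Type*) [AddCommGroup G] : Prop where
  torsionFree : IsAddTorsionFree G
  finiteRank : Module.rank ℤ G < Cardinal.aleph0
  exists_subgroup : ∃ A : AddSubgroup G, IsCompletelyDecomposable A ∧ A.FiniteIndex

/-- `A` is a completely decomposable subgroup of (finite and) least index of `G`. -/
def IsLeastIndex {G : Type*} [AddCommGroup G] (A : AddSubgroup G) : Prop :=
  IsCompletelyDecomposable A ∧ A.FiniteIndex ∧
    ∀ A' : AddSubgroup G, IsCompletelyDecomposable A' → A'.FiniteIndex → A.index ≤ A'.index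

/-- The regulator `Reg G`: the intersection of all completely decomposable subgroups of least
index. -/
def regulator (G : Type*) [AddCommGroup G] : AddSubgroup G :=
  sInf {A | IsLeastIndex A}

/-- A direct decomposition of `Reg G` into torsion-free groups of rank `1`. -/
structure RegulatorDecomposition (G : Type*) [AddCommGroup G] where
  /-- the number of summands -/
  n : ℕ
  /-- the summands -/
  summand : Fin n → AddSubgroup G
  isDecomposition : IsRankOneDecomposition summand (regulator G)

/-! ### Helper facts -/

theorem le_height {B : Type*} [AddCommGroup B] {p : Nat.Primes} {x : B} {k : ℕ}
    (h : ∃ y : B, ((p : ℕ) ^ k) • y = x) : (k : ℕ∞) ≤ height p x :=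
  le_iSup₂_of_le k h le_rfl

theorem height_le_of_imp {B : Type*} [AddCommGroup B] {p : Nat.Primes} {x z : B}
    (h : ∀ k : ℕ, (∃ y : B, ((p : ℕ) ^ k) • y = x) → ∃ y : B, ((p : ℕ) ^ k) • y = z) :
    height p x ≤ height p z :=
  iSup₂_le fun k hk => le_height (h k hk)

theorem height_le_nsmul {B : Type*} [AddCommGroup B] (p : Nat.Primes) (n : ℕ) (x : B) :
    height p x ≤ height p (n • x) :=
  height_le_of_imp fun k ⟨y, hy⟩ => ⟨n • y, by rw [smul_comm, hy]⟩

theorem dvd_of_coprime {B : Type*} [AddCommGroup B] {q n : ℕ} (hq : Nat.Coprime q n) {x : B}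
    (h : ∃ y : B, q • y = n • x) : ∃ y : B, q • y = x := by
  obtain ⟨y, hy⟩ := h
  have e := Nat.gcd_eq_gcd_ab q n
  rw [hq.gcd_eq_one] at e
  refine ⟨(q.gcdA n) • x + (q.gcdB n) • y, ?_⟩
  have hy' : (q : ℤ) • y = (n : ℤ) • x := by simpa using hy
  rw [← natCast_zsmul, smul_add, smul_comm (q : ℤ) (q.gcdB n) y, hy', smul_smul, smul_smul,
    ← add_smul, mul_comm (q.gcdB n), ← e]
  simp

theorem height_nsmul_of_coprime {B : Type*} [AddCommGroup B] {p : Nat.Primes} {n : ℕ}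
    (hp : ¬ (p : ℕ) ∣ n) (x : B) : height p (n • x) = height p x :=
  le_antisymm
    (height_le_of_imp fun k hk =>
      dvd_of_coprime (((Nat.Prime.coprime_iff_not_dvd p.2).2 hp).pow_left k) hk)
    (height_le_nsmul p n x)

theorem height_le_of_nsmul_pow {B : Type*} [AddCommGroup B] [IsAddTorsionFree B] (p : Nat.Primes)
    (a : ℕ) (x : B) : height p (((p : ℕ) ^ a) • x) ≤ height p x + a := by
  refine iSup₂_le fun k ⟨y, hy⟩ => ?_
  rcases le_total k a with hka | hka
  · exact le_add_left (by exact_mod_cast hka)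
  · obtain ⟨j, rfl⟩ := Nat.exists_eq_add_of_le hka
    have : ((p : ℕ) ^ j) • y = x := by
      rw [pow_add, mul_smul] at hy
      exact nsmul_right_injective (pow_ne_zero a p.2.ne_zero) hy
    rw [add_comm a j]
    push_cast
    gcongr
    exact le_height ⟨y, this⟩

/-- In a torsion-free group nonzero multiples of an element have the type of this element. -/
theorem elemType_nsmul {B : Type*} [AddCommGroup B] [IsAddTorsionFree B] {n : ℕ} (hn : n ≠ 0)
    (x : B) : elemType (n • x) = elemType x := by
  refine Quotient.sound ⟨?_, fun p => ?_⟩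
  · have hf : {p : Nat.Primes | (p : ℕ) ∣ n}.Finite := by
      refine Set.Finite.of_finite_image (f := fun p : Nat.Primes => (p : ℕ)) ?_
        Subtype.val_injective.injOn
      refine (Set.finite_Iic n).subset ?_
      rintro _ ⟨p, hp, rfl⟩
      exact Nat.le_of_dvd (Nat.pos_of_ne_zero hn) hp
    refine hf.subset fun p hp => ?_
    by_contra hc
    exact hp (height_nsmul_of_coprime hc x)
  · constructor
    · intro h
      obtain ⟨a, m, hm, rfl⟩ := Nat.exists_eq_pow_mul_and_not_dvd hn p p.2.ne_one
      have h1 : height p (((p : ℕ) ^ a * m) • x) = ⊤ := h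
      have h2 := height_le_of_nsmul_pow p a (m • x)
      rw [smul_smul, h1, height_nsmul_of_coprime hm, top_le_iff, ENat.add_eq_top] at h2
      exact h2.resolve_right (ENat.natCast_ne_top a)
    · intro h
      have h1 : height p x = ⊤ := h
      exact top_le_iff.1 (h1 ▸ height_le_nsmul p n x)

theorem height_neg {B : Type*} [AddCommGroup B] (p : Nat.Primes) (x : B) :
    height p (-x) = height p x := by
  have key : ∀ z : B, height p z ≤ height p (-z) := fun z =>
    height_le_of_imp fun k ⟨y, hy⟩ => ⟨-y, by rw [smul_neg, hy]⟩
  exact le_antisymm (by simpa using key (-x)) (key x)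

theorem elemType_zsmul {B : Type*} [AddCommGroup B] [IsAddTorsionFree B] {n : ℤ} (hn : n ≠ 0)
    (x : B) : elemType (n • x) = elemType x := by
  obtain ⟨m, rfl | rfl⟩ := n.eq_nat_or_neg
  · rw [natCast_zsmul]
    exact elemType_nsmul (by simpa using hn) x
  · rw [neg_smul, natCast_zsmul, ← elemType_nsmul (n := m) (by simpa using hn) x]
    unfold elemType
    congr 1
    funext p
    exact height_neg p _

/-- A torsion-free group of rank `1` has a unique type. -/
theorem IsRankOne.existsUnique_hasType {B : Type*} [AddCommGroup B] (hB : IsRankOne B) :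
    ∃! τ, HasType B τ := by
  have := hB.1
  have hnt : Nontrivial B := by
    by_contra hc
    rw [not_nontrivial_iff_subsingleton] at hc
    have h1 := hB.2
    rw [rank_subsingleton'] at h1
    exact zero_ne_one h1
  obtain ⟨e, he⟩ := exists_ne (0 : B)
  refine ⟨elemType e, ⟨hB, fun x hx => ?_⟩, fun τ hτ => (hτ.2 e he).symm⟩
  have hdep : ¬ LinearIndependent ℤ ![e, x] := by
    intro hli
    have h2 := hli.cardinal_lift_le_rank
    rw [hB.2] at h2
    simp at h2
  rw [LinearIndependent.pair_iff] at hdep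
  push Not at hdep
  obtain ⟨s, t, hst, hne⟩ := hdep
  have hs : s ≠ 0 := by
    rintro rfl
    have ht := hne rfl
    rw [zero_smul, zero_add] at hst
    exact (smul_ne_zero ht hx) hst
  have ht : t ≠ 0 := by
    rintro rfl
    rw [zero_smul, add_zero] at hst
    exact (smul_ne_zero hs he) hst
  have hx' : t • x = (-s) • e := by
    rw [neg_smul]
    exact eq_neg_of_add_eq_zero_right hst
  rw [← elemType_zsmul ht x, hx', elemType_zsmul (neg_ne_zero.2 hs)]

/-- Some positive multiple of `G` lies in the regulator. -/
theorem exists_nsmul_mem_regulator (G : Type*) [AddCommGroup G]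
    [h : IsAlmostCompletelyDecomposable G] :
    ∃ k : ℕ, 0 < k ∧ ∀ g : G, k • g ∈ regulator G := by
  classical
  have hex : ∃ k : ℕ, ∃ A : AddSubgroup G, IsCompletelyDecomposable A ∧ A.FiniteIndex ∧
      A.index = k := by
    obtain ⟨A, hA, hf⟩ := h.exists_subgroup
    exact ⟨_, A, hA, hf, rfl⟩
  obtain ⟨A₀, hA₀, hf₀, hk₀⟩ := Nat.find_spec hex
  refine ⟨Nat.find hex, hk₀ ▸ Nat.pos_of_ne_zero hf₀.index_ne_zero, fun g => ?_⟩
  rw [regulator, AddSubgroup.mem_sInf]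
  rintro A ⟨hA, hf, hmin⟩
  have : A.index = Nat.find hex :=
    le_antisymm (hk₀ ▸ hmin A₀ hA₀ hf₀) (Nat.find_min' hex ⟨A, hA, hf, rfl⟩)
  rw [← this]
  exact A.nsmul_index_mem g

/-- The divisible hull of a subgroup of `G`, as a `ℚ`-subspace of the divisible hull of `G`. -/
def hull {G : Type*} [AddCommGroup G] (A : AddSubgroup G) : Submodule ℚ (DivisibleHull G) :=
  Submodule.span ℚ (DivisibleHull.coeAddMonoidHom G '' (A : Set G))

theorem coe_nsmul {G : Type*} [AddCommGroup G] (k : ℕ) (a : G) :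
    DivisibleHull.coeAddMonoidHom G (k • a) = (k : ℚ) • DivisibleHull.coeAddMonoidHom G a := by
  rw [map_nsmul]
  exact (Nat.cast_smul_eq_nsmul ℚ _ _).symm

theorem coe_zsmul {G : Type*} [AddCommGroup G] (k : ℤ) (a : G) :
    DivisibleHull.coeAddMonoidHom G (k • a) = (k : ℚ) • DivisibleHull.coeAddMonoidHom G a := by
  rw [map_zsmul]
  exact (Int.cast_smul_eq_zsmul ℚ _ _).symm

theorem mem_hull {G : Type*} [AddCommGroup G] {A : AddSubgroup G} {v : DivisibleHull G}
    (hv : v ∈ hull A) :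
    ∃ k : ℕ, 0 < k ∧ ∃ a ∈ A, (k : ℚ) • v = DivisibleHull.coeAddMonoidHom G a := by
  induction hv using Submodule.span_induction with
  | mem x hx =>
    obtain ⟨a, ha, rfl⟩ := hx
    exact ⟨1, one_pos, a, ha, by simp⟩
  | zero => exact ⟨1, one_pos, 0, A.zero_mem, by simp⟩
  | add x y _ _ hx hy =>
    obtain ⟨k, hk, a, ha, hka⟩ := hx
    obtain ⟨l, hl, b, hb, hlb⟩ := hy
    refine ⟨k * l, Nat.mul_pos hk hl, l • a + k • b,
      A.add_mem (A.nsmul_mem ha l) (A.nsmul_mem hb k), ?_⟩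
    rw [map_add, coe_nsmul, coe_nsmul, ← hka, ← hlb, smul_add, smul_smul, smul_smul]
    push_cast
    rw [mul_comm (l : ℚ) k]
  | smul q x _ hx =>
    obtain ⟨k, hk, a, ha, hka⟩ := hx
    refine ⟨q.den * k, Nat.mul_pos q.den_pos hk, q.num • a, A.zsmul_mem ha _, ?_⟩
    rw [coe_zsmul, ← hka, smul_smul, smul_smul]
    congr 1
    push_cast
    rw [mul_right_comm, Rat.den_mul_eq_num]

theorem iSupIndep_hull {G ι : Type*} [AddCommGroup G] [IsAddTorsionFree G]
    {A : ι → AddSubgroup G} (hA : iSupIndep A) : iSupIndep fun i => hull (A i) := by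
  classical
  rw [iSupIndep_iff_finsetSum_eq_zero_imp_eq_zero]
  intro s v hv hsum i hi
  have hv' : ∀ i : ι, ∃ k : ℕ, 0 < k ∧ (i ∈ s →
      ∃ a ∈ A i, (k : ℚ) • v i = DivisibleHull.coeAddMonoidHom G a) := by
    intro i
    by_cases h : i ∈ s
    · obtain ⟨k, hk, h'⟩ := mem_hull (hv i h)
      exact ⟨k, hk, fun _ => h'⟩
    · exact ⟨1, one_pos, fun h' => absurd h' h⟩
  choose k hk hka using hv'
  have hK : ∀ j ∈ s, ∃ a ∈ A j,
      ((∏ l ∈ s, k l : ℕ) : ℚ) • v j = DivisibleHull.coeAddMonoidHom G a := by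
    intro j hj
    obtain ⟨a, ha, e⟩ := hka j hj
    refine ⟨(∏ l ∈ s.erase j, k l) • a, (A j).nsmul_mem ha _, ?_⟩
    rw [coe_nsmul, ← e, smul_smul, ← Nat.cast_mul, Finset.prod_erase_mul _ _ hj]
  choose! a ha hae using hK
  have hinj : Function.Injective (DivisibleHull.coeAddMonoidHom G) :=
    DivisibleHull.coe_injective
  have hs0 : ∑ j ∈ s, a j = 0 := by
    apply hinj
    rw [map_sum, map_zero, ← Finset.sum_congr rfl hae, ← Finset.smul_sum, hsum, smul_zero]
  have hA' : iSupIndep fun i => AddSubgroup.toIntSubmodule (A i) :=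
    hA.map_orderIso AddSubgroup.toIntSubmodule
  have h0 := (iSupIndep_iff_finsetSum_eq_zero_imp_eq_zero _).1 hA' s a ha hs0 i hi
  have h1 := hae i hi
  rw [h0, map_zero] at h1
  refine (smul_eq_zero.1 h1).resolve_left ?_
  exact_mod_cast (Finset.prod_pos fun l _ => hk l).ne'

/-! ### Critical types, rigid groups, groups of ring type -/

namespace RegulatorDecomposition

variable {G : Type*} [AddCommGroup G] (D : RegulatorDecomposition G)

/-- `Reg_τ G`, the sum of the summands of type `τ` in the given decomposition of `Reg G`. -/
def component (τ : GroupType) : AddSubgroup G :=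
  ⨆ (i : Fin D.n) (_ : HasType (D.summand i) τ), D.summand i

/-- The set `T(G)` of critical types. -/
def criticalTypes : Set GroupType := {τ | D.component τ ≠ ⊥}

/-- The critical types are pairwise non-comparable. -/
def IsBlockRigid : Prop :=
  ∀ τ ∈ D.criticalTypes, ∀ σ ∈ D.criticalTypes, τ ≠ σ → ¬ τ ≤ σ ∧ ¬ σ ≤ τ

/-- `G` is block-rigid, and all the groups `Reg_τ G`, where `τ ∈ T(G)`, have rank `1`. -/
def IsRigid : Prop :=
  D.IsBlockRigid ∧ ∀ τ ∈ D.criticalTypes, Module.rank ℤ (D.component τ) = 1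

/-- All critical types are idempotent. -/
def IsOfRingType : Prop := ∀ τ ∈ D.criticalTypes, τ.IsIdempotent

theorem exists_hasType_of_mem {τ : GroupType} (h : τ ∈ D.criticalTypes) :
    ∃ i, HasType (D.summand i) τ := by
  by_contra hc
  push Not at hc
  exact h (by simp [component, hc])

instance : Finite D.criticalTypes := by
  choose f hf using fun τ : D.criticalTypes => D.exists_hasType_of_mem τ.2
  refine Finite.of_injective f fun τ σ h => Subtype.ext ?_
  exact (D.isDecomposition.rankOne (f τ)).existsUnique_hasType.unique (hf τ) (h ▸ hf σ)

instance : Fintype D.criticalTypes := Fintype.ofFinite _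

instance : DecidableEq D.criticalTypes := Classical.decEq _

theorem iSupIndep_component : iSupIndep D.component := by
  rw [iSupIndep_def]
  intro τ
  have key := D.isDecomposition.indep.disjoint_biSup_biSup'
    (s := {i | HasType (D.summand i) τ}) (t := {i | ¬ HasType (D.summand i) τ})
    (by rw [Set.disjoint_left]; exact fun i hi hi' => hi' hi) (Set.toFinite _)
  refine key.mono le_rfl ?_
  refine iSup₂_le fun σ hσ => iSup₂_le fun i hi => ?_
  refine le_iSup₂_of_le i ?_ le_rfl
  exact fun hi' => hσ
    ((D.isDecomposition.rankOne i).existsUnique_hasType.unique hi hi')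

theorem iSup_component : ⨆ τ : D.criticalTypes, D.component τ = regulator G := by
  refine le_antisymm (iSup_le fun τ => iSup₂_le fun i _ => ?_) ?_
  · rw [← D.isDecomposition.iSup_eq]
    exact le_iSup D.summand i
  · rw [← D.isDecomposition.iSup_eq]
    refine iSup_le fun i => ?_
    obtain ⟨τ, hτ, -⟩ := (D.isDecomposition.rankOne i).existsUnique_hasType
    have hle : D.summand i ≤ D.component τ := le_iSup₂_of_le i hτ le_rfl
    by_cases h : D.component τ = ⊥
    · exact hle.trans (h ▸ bot_le)
    · exact hle.trans (le_iSup (fun σ : D.criticalTypes => D.component σ) ⟨τ, h⟩)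

/-! ### The divisible hull -/

variable [IsAlmostCompletelyDecomposable G]

/-- The divisible hull of `G` is the direct sum of the divisible hulls of the `Reg_τ G`. -/
theorem isInternal_hull :
    DirectSum.IsInternal fun τ : D.criticalTypes => hull (D.component τ) := by
  have : IsAddTorsionFree G := IsAlmostCompletelyDecomposable.torsionFree
  refine DirectSum.isInternal_submodule_of_iSupIndep_of_iSup_eq_top ?_ ?_
  · exact iSupIndep_hull (D.iSupIndep_component.comp Subtype.val_injective)
  · rw [eq_top_iff]
    rintro v -
    have hreg : ∀ a ∈ regulator G, DivisibleHull.coeAddMonoidHom G a ∈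
        ⨆ τ : D.criticalTypes, hull (D.component τ) := by
      have hle : regulator G ≤ AddSubgroup.comap (DivisibleHull.coeAddMonoidHom G)
          (⨆ τ : D.criticalTypes, hull (D.component τ)).toAddSubgroup := by
        rw [← D.iSup_component]
        refine iSup_le fun τ a ha => ?_
        exact Submodule.mem_iSup_of_mem τ (Submodule.subset_span ⟨a, ha, rfl⟩)
      exact fun a ha => hle ha
    obtain ⟨k, hk, hkG⟩ := exists_nsmul_mem_regulator G
    induction v with
    | mk g s =>
      have e : DivisibleHull.mk g s =
          ((k * (s : ℕ) : ℕ) : ℚ)⁻¹ • DivisibleHull.coeAddMonoidHom G (k • g) := by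
        have hne : ((k * (s : ℕ) : ℕ) : ℚ) ≠ 0 := by
          exact_mod_cast (Nat.mul_pos hk s.pos).ne'
        rw [eq_inv_smul_iff₀ hne, DivisibleHull.qsmul_mk,
          DivisibleHull.coeAddMonoidHom_apply, DivisibleHull.mk_eq_mk]
        refine ⟨1, ?_⟩
        simp only [Rat.num_natCast, Rat.den_natCast, natCast_zsmul, smul_smul]
        simp [mul_comm]
      rw [e]
      exact Submodule.smul_mem _ _ (hreg _ (hkG g))

theorem bijective_hull : Function.Bijective
    (DirectSum.coeLinearMap fun τ : D.criticalTypes => hull (D.component τ)) :=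
  D.isInternal_hull

/-- The projection `π_τ` of the divisible hull of `G` onto the divisible hull of `Reg_τ G`. -/
def proj (τ : D.criticalTypes) : DivisibleHull G →ₗ[ℚ] DivisibleHull G :=
  (hull (D.component τ)).subtype ∘ₗ
    DirectSum.component ℚ D.criticalTypes (fun σ => hull (D.component σ)) τ ∘ₗ
      (LinearEquiv.ofBijective (DirectSum.coeLinearMap fun σ : D.criticalTypes =>
        hull (D.component σ)) D.bijective_hull).symm.toLinearMap

theorem proj_of_mem {τ : D.criticalTypes} {v : DivisibleHull G} (hv : v ∈ hull (D.component τ))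
    (σ : D.criticalTypes) : D.proj σ v = if σ = τ then v else 0 := by
  have key : (LinearEquiv.ofBijective (DirectSum.coeLinearMap fun σ : D.criticalTypes =>
        hull (D.component σ)) D.bijective_hull).symm v
      = DirectSum.lof ℚ D.criticalTypes (fun σ => hull (D.component σ)) τ ⟨v, hv⟩ := by
    rw [LinearEquiv.symm_apply_eq, LinearEquiv.ofBijective_apply, DirectSum.coeLinearMap_lof]
  unfold proj
  rw [LinearMap.comp_apply, LinearMap.comp_apply, LinearEquiv.coe_coe, key]
  by_cases h : σ = τ
  · subst h
    rw [DirectSum.component.lof_self, if_pos rfl]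
    rfl
  · rw [DirectSum.component.of, dif_neg (Ne.symm h), if_neg h, map_zero]

/-- The order `m_τ` of the coset of `d_τ = π_τ(d)` modulo `Reg G` in the quotient of the divisible
hull by `Reg G`. -/
def m (d : G) (τ : D.criticalTypes) : ℕ :=
  addOrderOf (QuotientAddGroup.mk (D.proj τ (d : DivisibleHull G)) :
    DivisibleHull G ⧸ (regulator G).map (DivisibleHull.coeAddMonoidHom G))

/-- Multiplication by a family of rational numbers: the element `x = ∑ x_τ` of the divisible hull,
where `x_τ = π_τ(x)`, is sent to `∑ c_τ x_τ`. -/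
def mulBy (c : D.criticalTypes → ℚ) (x : DivisibleHull G) : DivisibleHull G :=
  ∑ τ, c τ • D.proj τ x

end RegulatorDecomposition

/-! ### The ring `K_G` -/

/-- The family `1_{T₀}`, where `T₀` is the set of all `τ ∈ T` with `m_τ > 1`: its `τ`-th member is
`1` if `τ ∈ T₀`, and `0` otherwise. (The numbers `m_τ` are positive, so that `m_τ > 1` means
`m_τ ≠ 1`.) -/
def oneT₀ {T : Type*} (R : T → Subring ℚ) (m : T → ℕ) : ∀ τ, R τ :=
  fun τ => if m τ = 1 then 0 else 1

/-- For subrings `R_τ` of `ℚ` and positive integers `m_τ` (`τ ∈ T`), the subring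
`ℤ 1_{T₀} + ∏ m_τ R_τ` of the ring `∏ R_τ`. -/
def kRing {T : Type*} (R : T → Subring ℚ) (m : T → ℕ) : Subring (∀ τ, R τ) where
  carrier := {c | ∃ (γ : ℤ) (y : ∀ τ, R τ), c = γ • oneT₀ R m + fun τ => m τ • y τ}
  one_mem' := by
    refine ⟨1, fun τ => if m τ = 1 then 1 else 0, ?_⟩
    funext τ
    by_cases h : m τ = 1 <;> simp [oneT₀, h]
  mul_mem' := by
    rintro _ _ ⟨γ, y, rfl⟩ ⟨δ, z, rfl⟩
    refine ⟨γ * δ, fun τ => γ • (oneT₀ R m τ * z τ) + δ • (y τ * oneT₀ R m τ)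
      + m τ • (y τ * z τ), ?_⟩
    funext τ
    by_cases h : m τ = 1
    · simp [oneT₀, h]
    · simp only [oneT₀, h, if_false, Pi.mul_apply, Pi.add_apply, Pi.intCast_apply,
        zsmul_eq_mul, nsmul_eq_mul]
      push_cast
      ring
  zero_mem' := ⟨0, 0, by funext τ; simp⟩
  add_mem' := by
    rintro _ _ ⟨γ, y, rfl⟩ ⟨δ, z, rfl⟩
    refine ⟨γ + δ, y + z, ?_⟩
    funext τ
    simp only [Pi.add_apply, Pi.smul_apply, add_smul, smul_add]
    abel
  neg_mem' := by
    rintro _ ⟨γ, y, rfl⟩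
    refine ⟨-γ, -y, ?_⟩
    funext τ
    simp only [Pi.add_apply, Pi.smul_apply, Pi.neg_apply, neg_smul, smul_neg]
    abel

end ACD

end

/-!
Since the critical types are pairwise incomparable, an endomorphism of `G` maps `Reg_τ G` into its
divisible hull, a line over `ℚ`; hence it is the multiplication by a family `c` of rational numbers.
Applied to a multiple of the projection onto a summand of an arbitrary completely decomposable
subgroup of finite index, this shows that each such summand lies in the pure subgroup generated by
some `Reg_τ G`. So the direct sum of these pure subgroups is the regulator, the `Reg_τ G` are pure
in `G`, and `c_τ` lies in the ring of all multipliers of `Reg_τ G`, which is `R_τ`.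

As `G = ℤ d + Reg G`, the multiplication by `c ∈ ∏ R_τ` preserves `G` if and only if
`c d - γ d ∈ Reg G` for some integer `γ`; read in each component, this is `c_τ - γ ∈ m_τ R_τ`.
-/

namespace ACD

local notation "ι" => DivisibleHull.coeAddMonoidHom

section RankOne

variable {B C : Type*} [AddCommGroup B] [AddCommGroup C]

namespace IsRankOne

theorem of_injective (hB : IsRankOne B) {f : B →+ C} {g : C →+ B} (hf : Function.Injective f)
    (hg : Function.Injective g) : IsRankOne C := by
  have := hB.1
  refine ⟨hg.isAddTorsionFree g, ?_⟩
  have hle := g.toIntLinearMap.lift_rank_le_of_injective hg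
  have hge := f.toIntLinearMap.lift_rank_le_of_injective hf
  rw [hB.2, Cardinal.lift_one] at hle hge
  exact le_antisymm (Cardinal.lift_le_one_iff.1 hle) (Cardinal.one_le_lift_iff.1 hge)

theorem exists_ne_zero (hB : IsRankOne B) : ∃ e : B, e ≠ 0 := by
  have := hB.1
  have : Nontrivial B := rank_pos_iff_nontrivial.1 (hB.2 ▸ zero_lt_one)
  exact exists_ne 0

theorem exists_zsmul_eq (hB : IsRankOne B) {e : B} (he : e ≠ 0) (x : B) :
    ∃ s t : ℤ, s ≠ 0 ∧ s • x = t • e := by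
  have := hB.1
  have hdep : ¬ LinearIndependent ℤ ![e, x] := fun hli => by
    simpa [hB.2] using hli.cardinal_lift_le_rank
  rw [LinearIndependent.pair_iff] at hdep
  push Not at hdep
  obtain ⟨s, t, hst, hne⟩ := hdep
  refine ⟨t, -s, ?_, by rw [neg_smul]; exact eq_neg_of_add_eq_zero_right hst⟩
  rintro rfl
  exact smul_ne_zero (fun hs => hne hs rfl) he (by simpa using hst)

theorem hom_ext [IsAddTorsionFree C] (hB : IsRankOne B) {e : B} (he : e ≠ 0) {f g : B →+ C}
    (h : f e = g e) : f = g := by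
  ext x
  obtain ⟨s, t, hs, hst⟩ := hB.exists_zsmul_eq he x
  refine zsmul_right_injective hs ?_
  simp only [← map_zsmul, hst]
  rw [map_zsmul, map_zsmul, h]

end IsRankOne

end RankOne

section Heights

variable {B C : Type*} [AddCommGroup B] [AddCommGroup C]

theorem height_le_map (f : B →+ C) (p : Nat.Primes) (x : B) : height p x ≤ height p (f x) :=
  iSup₂_le fun _ ⟨y, hy⟩ => le_height ⟨f y, by rw [← map_nsmul, hy]⟩

theorem height_map_addEquiv (e : B ≃+ C) (p : Nat.Primes) (x : B) :
    height p (e x) = height p x :=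
  le_antisymm (by simpa using height_le_map e.symm.toAddMonoidHom p (e x))
    (height_le_map e.toAddMonoidHom p x)

theorem natCast_le_height_iff {p : Nat.Primes} {k : ℕ} {x : B} :
    (k : ℕ∞) ≤ height p x ↔ ∃ y : B, ((p : ℕ) ^ k) • y = x := by
  refine ⟨fun h => ?_, le_height⟩
  by_contra hk
  have hlt : ∀ j, (∃ y : B, ((p : ℕ) ^ j) • y = x) → j < k := by
    rintro j ⟨y, rfl⟩
    by_contra! hkj
    exact hk ⟨(p : ℕ) ^ (j - k) • y, by rw [smul_smul, pow_mul_pow_sub _ hkj]⟩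
  have hpos : 0 < k := hlt 0 ⟨x, by simp⟩
  have hle : height p x ≤ (k - 1 : ℕ) :=
    iSup₂_le fun j hj => Nat.cast_le.2 (Nat.le_sub_one_of_lt (hlt j hj))
  exact absurd (Nat.cast_le.1 (h.trans hle)) (by omega)

theorem surjective_nsmul_iff_height_eq_top {p : Nat.Primes} :
    Function.Surjective (fun x : B => (p : ℕ) • x) ↔ ∀ x : B, height p x = ⊤ := by
  refine ⟨fun hsurj x => ENat.eq_top_iff_forall_ge.2 fun k => le_height ?_, fun h x => ?_⟩
  · obtain ⟨y, hy⟩ := hsurj.iterate k x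
    exact ⟨y, by rwa [smul_iterate] at hy⟩
  · simpa using natCast_le_height_iff.1 ((h x).symm ▸ le_top : ((1 : ℕ) : ℕ∞) ≤ height p x)

theorem surjective_nsmul_iff_forall_prime {n : ℕ} (hn : n ≠ 0) :
    Function.Surjective (fun x : B => n • x) ↔
      ∀ p : Nat.Primes, (p : ℕ) ∣ n → Function.Surjective (fun x : B => (p : ℕ) • x) := by
  refine ⟨?_, ?_⟩
  · rintro hsurj p ⟨m, rfl⟩ x
    obtain ⟨y, rfl⟩ := hsurj x
    exact ⟨m • y, smul_smul _ _ _⟩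
  · induction n using induction_on_primes with
    | zero => exact absurd rfl hn
    | one => exact fun _ x => ⟨x, one_smul ℕ x⟩
    | prime_mul p m hp ih =>
      intro h x
      obtain ⟨y, rfl⟩ := h ⟨p, hp⟩ (dvd_mul_right p m) x
      obtain ⟨z, rfl⟩ := ih (right_ne_zero_of_mul hn) (fun q hq => h q (hq.mul_left p)) y
      exact ⟨z, mul_smul p m z⟩

namespace HasType

variable {τ σ : GroupType}

theorem le_of_hom_ne_zero (hB : HasType B τ) (hC : HasType C σ) {f : B →+ C} (hf : f ≠ 0) :
    τ ≤ σ := by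
  obtain ⟨x, hx⟩ := DFunLike.ne_iff.1 hf
  have hx₀ : x ≠ 0 := fun h => hx (by simp [h])
  exact ⟨_, _, hB.2 x hx₀, hC.2 (f x) hx, fun p => height_le_map f p x⟩

theorem of_addEquiv (hB : HasType B τ) (e : B ≃+ C) : HasType C τ := by
  refine ⟨hB.1.of_injective (f := e.toAddMonoidHom) (g := e.symm.toAddMonoidHom) e.injective
    e.symm.injective, fun y hy => ?_⟩
  rw [← hB.2 (e.symm y) (by simpa using hy), elemType, elemType]
  congr 1
  exact funext fun p => (height_map_addEquiv e.symm p y).symm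

theorem surjective_nsmul_prime_iff (hB : HasType B τ) {p : Nat.Primes} {x : B} (hx : x ≠ 0) :
    Function.Surjective (fun y : B => (p : ℕ) • y) ↔ height p x = ⊤ := by
  refine surjective_nsmul_iff_height_eq_top.trans ⟨fun h => h x, fun h y => ?_⟩
  rcases eq_or_ne y 0 with rfl | hy
  · exact ENat.eq_top_iff_forall_ge.2 fun k => le_height ⟨0, smul_zero _⟩
  · exact ((Quotient.exact ((hB.2 x hx).trans (hB.2 y hy).symm)).2 p).1 h

theorem surjective_nsmul_iff (hB : HasType B τ) (hC : HasType C τ) {n : ℕ} (hn : n ≠ 0) :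
    Function.Surjective (fun x : B => n • x) ↔ Function.Surjective (fun x : C => n • x) := by
  obtain ⟨x, hx⟩ := hB.1.exists_ne_zero
  obtain ⟨y, hy⟩ := hC.1.exists_ne_zero
  have htype : elemType x = elemType y := (hB.2 x hx).trans (hC.2 y hy).symm
  rw [surjective_nsmul_iff_forall_prime hn, surjective_nsmul_iff_forall_prime hn]
  refine forall₂_congr fun p _ => ?_
  rw [hB.surjective_nsmul_prime_iff hx, hC.surjective_nsmul_prime_iff hy]
  exact (Quotient.exact htype).2 p

end HasType

end Heights

section Multipliers

theorem inv_den_mem_iff {R : Subring ℚ} {c : ℚ} : (c.den : ℚ)⁻¹ ∈ R ↔ c ∈ R := by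
  refine ⟨fun h => ?_, fun hc => ?_⟩
  · rw [← Rat.num_div_den c, div_eq_mul_inv]
    exact R.mul_mem (intCast_mem R _) h
  · obtain ⟨u, w, huw⟩ := c.isCoprime_num_den
    have huw' : (u * c.num + w * c.den : ℚ) = 1 := mod_cast huw
    have : (c.den : ℚ)⁻¹ = u * c + w := inv_eq_of_mul_eq_one_left <| by
      rw [← huw', ← Rat.den_mul_eq_num]
      ring
    rw [this]
    exact R.add_mem (R.mul_mem (intCast_mem R _) hc) (intCast_mem R _)

variable {V W : Type*} [AddCommGroup V] [Module ℚ V] [AddCommGroup W] [Module ℚ W]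

/-- The ring of all rational numbers `c` with `c M ⊆ M`, where `M` is a subgroup of a rational
vector space; for `M` of rank one this is the endomorphism ring of `M`. -/
def multiplierSubring (M : AddSubgroup V) : Subring ℚ where
  carrier := {c | ∀ v ∈ M, c • v ∈ M}
  one_mem' v hv := by rwa [one_smul]
  mul_mem' ha hb v hv := by rw [mul_smul]; exact ha _ (hb v hv)
  zero_mem' v _ := by rw [zero_smul]; exact M.zero_mem
  add_mem' ha hb v hv := by rw [add_smul]; exact M.add_mem (ha v hv) (hb v hv)
  neg_mem' ha v hv := by rw [neg_smul]; exact M.neg_mem (ha v hv)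

theorem inv_natCast_mem_multiplierSubring {M : AddSubgroup V} {n : ℕ} (hn : n ≠ 0) :
    (n : ℚ)⁻¹ ∈ multiplierSubring M ↔ Function.Surjective (fun x : M => n • x) := by
  have hn' : (n : ℚ) ≠ 0 := Nat.cast_ne_zero.2 hn
  constructor
  · intro h x
    refine ⟨⟨_, h x x.2⟩, Subtype.ext ?_⟩
    rw [AddSubgroup.coe_nsmul, ← Nat.cast_smul_eq_nsmul ℚ, smul_inv_smul₀ hn']
  · intro h v hv
    obtain ⟨y, hy⟩ := h ⟨v, hv⟩
    have hy' : (n : ℚ) • (y : V) = v := by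
      rw [Nat.cast_smul_eq_nsmul]; exact congrArg Subtype.val hy
    rw [← hy', inv_smul_smul₀ hn']
    exact y.2

theorem HasType.multiplierSubring_congr {τ : GroupType} {M : AddSubgroup V} {N : AddSubgroup W}
    (hM : HasType M τ) (hN : HasType N τ) : multiplierSubring M = multiplierSubring N := by
  ext c
  rw [← inv_den_mem_iff, ← inv_den_mem_iff (c := c),
    inv_natCast_mem_multiplierSubring c.den_ne_zero,
    inv_natCast_mem_multiplierSubring c.den_ne_zero, hM.surjective_nsmul_iff hN c.den_ne_zero]

theorem multiplierSubring_toAddSubgroup (R : Subring ℚ) :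
    multiplierSubring R.toAddSubgroup = R := by
  ext c
  exact ⟨fun h => by simpa using h 1 R.one_mem, fun hc v hv => R.mul_mem hc hv⟩

theorem HasType.multiplierSubring_eq {τ : GroupType} {M : AddSubgroup V} {R : Subring ℚ}
    (hM : HasType M τ) (hR : HasType R τ) : multiplierSubring M = R :=
  (hM.multiplierSubring_congr (N := R.toAddSubgroup) hR).trans (multiplierSubring_toAddSubgroup R)

theorem smul_mem_iff_exists_eq_addOrderOf_mul {M : AddSubgroup V} {r : ℚ}
    (hr : r ∈ multiplierSubring M) (v : V) :
    r • v ∈ M ↔ ∃ y ∈ multiplierSubring M, r = addOrderOf (v : V ⧸ M) * y := by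
  constructor
  · intro hrv
    have hnum : r.num • v ∈ M := by
      rw [← Int.cast_smul_eq_zsmul ℚ, ← Rat.den_mul_eq_num, mul_smul, Nat.cast_smul_eq_nsmul]
      exact M.nsmul_mem hrv _
    obtain ⟨w, hw⟩ : (addOrderOf (v : V ⧸ M) : ℤ) ∣ r.num := by
      rw [addOrderOf_dvd_iff_zsmul_eq_zero]
      exact (QuotientAddGroup.eq_zero_iff _).2 hnum
    refine ⟨w * (r.den : ℚ)⁻¹, Subring.mul_mem _ (intCast_mem _ w)
      (inv_den_mem_iff.2 hr), ?_⟩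
    conv_lhs => rw [← Rat.num_div_den r, hw]
    push_cast
    ring
  · rintro ⟨y, hy, rfl⟩
    have horder : addOrderOf (v : V ⧸ M) • v ∈ M :=
      (QuotientAddGroup.eq_zero_iff _).1 (addOrderOf_nsmul_eq_zero (v : V ⧸ M))
    rw [mul_comm, mul_smul, Nat.cast_smul_eq_nsmul]
    exact hy _ horder

end Multipliers

section Subgroups

variable {G : Type*} [AddCommGroup G]

namespace IsRankOne

theorem eq_bot_of_disjoint {P A B : AddSubgroup G} (hP : IsRankOne P) (hA : A ≤ P) (hB : B ≤ P)
    (hAB : Disjoint A B) (hA₀ : A ≠ ⊥) : B = ⊥ := by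
  have := hP.1
  obtain ⟨⟨a, ha⟩, ha₀⟩ := A.ne_bot_iff_exists_ne_zero.1 hA₀
  rw [eq_bot_iff]
  intro b hb
  obtain ⟨s, t, hs, hst⟩ := hP.exists_zsmul_eq (e := ⟨a, hA ha⟩) (by simpa using ha₀) ⟨b, hB hb⟩
  have hst' : s • b = t • a := congrArg Subtype.val hst
  have hsb : s • b = 0 :=
    AddSubgroup.disjoint_def.1 hAB (hst' ▸ A.zsmul_mem ha t) (B.zsmul_mem hb s)
  have : s • (⟨b, hB hb⟩ : P) = 0 := Subtype.ext hsb
  simpa using (smul_eq_zero_iff_right hs).1 this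

theorem hull_eq_span_singleton {A : AddSubgroup G} (hA : IsRankOne A) {e : G} (heA : e ∈ A)
    (he : e ≠ 0) : hull A = Submodule.span ℚ {ι G e} := by
  refine le_antisymm (Submodule.span_le.2 ?_)
    (Submodule.span_mono (Set.singleton_subset_iff.2 ⟨e, heA, rfl⟩))
  rintro _ ⟨x, hx, rfl⟩
  obtain ⟨s, t, hs, hst⟩ := hA.exists_zsmul_eq (e := ⟨e, heA⟩) (by simpa using he) ⟨x, hx⟩
  have hst' : s • x = t • e := congrArg Subtype.val hst
  refine Submodule.mem_span_singleton.2 ⟨(s : ℚ)⁻¹ * t, ?_⟩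
  rw [mul_smul, ← coe_zsmul, ← hst', coe_zsmul, inv_smul_smul₀ (Int.cast_ne_zero.2 hs)]

end IsRankOne

theorem exists_hom_eq_nsmul_of_disjoint {H K : AddSubgroup G} (hHK : Disjoint H K) {l : ℕ}
    (hl : ∀ g : G, l • g ∈ H ⊔ K) : ∃ θ : G →+ H, ∀ b : H, θ b = l • b := by
  let s : H × K →+ G := H.subtype.coprod K.subtype
  have hs : Function.Injective s := AddSubgroup.add_injective_of_disjoint hHK
  have hrange : ∀ g, nsmulAddMonoidHom l g ∈ s.range := fun g => by
    obtain ⟨h, hh, k, hk, hhk⟩ := AddSubgroup.mem_sup.1 (hl g)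
    exact ⟨(⟨h, hh⟩, ⟨k, hk⟩), hhk⟩
  let e : H × K ≃+ s.range := s.ofInjective hs
  refine ⟨(AddMonoidHom.fst H K).comp
    (e.symm.toAddMonoidHom.comp ((nsmulAddMonoidHom l).codRestrict s.range hrange)), fun b => ?_⟩
  have : e.symm ⟨l • b, hrange b⟩ = (l • b, 0) :=
    e.symm_apply_eq.2 (Subtype.ext (add_zero (l • (b : G))).symm)
  exact congrArg Prod.fst this

/-- The pure subgroup generated by `A`, when `G` is torsion-free: all `x` with `k x ∈ A` for some
`k > 0`. -/
noncomputable def purification (A : AddSubgroup G) : AddSubgroup G :=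
  (hull A).toAddSubgroup.comap (ι G)

theorem le_purification (A : AddSubgroup G) : A ≤ purification A :=
  fun a ha => Submodule.subset_span ⟨a, ha, rfl⟩

theorem iSupIndep_purification [IsAddTorsionFree G] {T : Type*} {A : T → AddSubgroup G}
    (hA : iSupIndep A) : iSupIndep fun i => purification (A i) := by
  refine fun i => AddSubgroup.disjoint_def.2 fun {x} hx hx' => ?_
  have hle : ⨆ (j) (_ : j ≠ i), purification (A j) ≤
      (⨆ (j) (_ : j ≠ i), hull (A j)).toAddSubgroup.comap (ι G) :=
    iSup₂_le fun j hj y hy => le_iSup₂ (f := fun j (_ : j ≠ i) => hull (A j)) j hj hy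
  have hx₀ : ι G x = 0 := Submodule.disjoint_def.1 (iSupIndep_hull hA i) _ hx (hle hx')
  exact (map_eq_zero_iff (ι G) DivisibleHull.coe_injective).1 hx₀

theorem isCompletelyDecomposable_iSup {T : Type*} [Finite T] {B : T → AddSubgroup G}
    (hB : ∀ i, IsRankOne (B i)) (hind : iSupIndep B) : IsCompletelyDecomposable (⨆ i, B i) :=
  ⟨_, B ∘ (Finite.equivFin T).symm, fun _ => hB _,
    hind.comp (Finite.equivFin T).symm.injective, (Finite.equivFin T).symm.iSup_comp⟩

theorem IsLeastIndex.eq_of_le {A C : AddSubgroup G} (hA : IsLeastIndex A)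
    (hC : IsCompletelyDecomposable C) (hAC : A ≤ C) : A = C := by
  have := hA.2.1
  by_contra hne
  exact (AddSubgroup.index_strictAnti (hAC.lt_of_ne hne)).not_ge
    (hA.2.2 C hC (AddSubgroup.finiteIndex_of_le hAC))

theorem exists_sub_zsmul_mem {A : AddSubgroup G} {d : G}
    (hd : AddSubgroup.zmultiples (d : G ⧸ A) = ⊤) (g : G) : ∃ n : ℤ, g - n • d ∈ A := by
  obtain ⟨n, hn⟩ := AddSubgroup.mem_zmultiples_iff.1 (hd ▸ AddSubgroup.mem_top (g : G ⧸ A))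
  exact ⟨n, by rw [← QuotientAddGroup.eq_zero_iff, QuotientAddGroup.mk_sub,
    QuotientAddGroup.mk_zsmul, hn, sub_self]⟩

end Subgroups

theorem mem_kRing_iff {T : Type*} {R : T → Subring ℚ} {m : T → ℕ} {c : ∀ τ, R τ} :
    c ∈ kRing R m ↔ ∃ γ : ℤ, ∀ τ, ∃ y ∈ R τ, (c τ : ℚ) - γ = m τ * y := by
  constructor
  · rintro ⟨γ, y, rfl⟩
    refine ⟨γ, fun τ => ?_⟩
    by_cases h : m τ = 1
    · exact ⟨y τ - γ, (R τ).sub_mem (y τ).2 (intCast_mem _ _), by simp [oneT₀, h]⟩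
    · exact ⟨y τ, (y τ).2, by simp [oneT₀, h]⟩
  · rintro ⟨γ, h⟩
    choose y hy hc using h
    refine ⟨γ, fun τ => if m τ = 1 then c τ else ⟨y τ, hy τ⟩, ?_⟩
    funext τ
    by_cases h : m τ = 1
    · simp [oneT₀, h]
    · refine Subtype.ext ?_
      simp [oneT₀, h, ← hc]

namespace RegulatorDecomposition

variable {G : Type*} [AddCommGroup G] {D : RegulatorDecomposition G}

theorem exists_mem_component_ne_zero (τ : D.criticalTypes) : ∃ x ∈ D.component τ, x ≠ 0 := by
  simpa using AddSubgroup.ne_bot_iff_exists_ne_zero.1 τ.2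

theorem component_eq_summand {τ : GroupType} (hrank : IsRankOne (D.component τ)) {i : Fin D.n}
    (hi : HasType (D.summand i) τ) : D.component τ = D.summand i := by
  have hle : ∀ j, HasType (D.summand j) τ → D.summand j ≤ D.component τ :=
    fun j hj => le_iSup₂_of_le j hj le_rfl
  have hi₀ : D.summand i ≠ ⊥ := by
    obtain ⟨e, he⟩ := hi.1.exists_ne_zero
    exact (D.summand i).ne_bot_iff_exists_ne_zero.2 ⟨e, he⟩
  refine le_antisymm (iSup₂_le fun j hj => ?_) (hle i hi)
  rcases eq_or_ne i j with rfl | hij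
  · exact le_rfl
  · rw [hrank.eq_bot_of_disjoint (hle i hi) (hle j hj)
      (D.isDecomposition.indep.pairwiseDisjoint hij) hi₀]
    exact bot_le

theorem component_le_regulator (τ : GroupType) : D.component τ ≤ regulator G :=
  D.isDecomposition.iSup_eq ▸ iSup₂_le fun i _ => le_iSup D.summand i

variable [IsAlmostCompletelyDecomposable G]

attribute [local instance] IsAlmostCompletelyDecomposable.torsionFree
  IsAddTorsionFree.of_module_rat

theorem IsRigid.hasType_component (hD : D.IsRigid) (τ : D.criticalTypes) :
    HasType (D.component τ) τ := by
  obtain ⟨i, hi⟩ := D.exists_hasType_of_mem τ.2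
  rw [component_eq_summand ⟨inferInstance, hD.2 τ τ.2⟩ hi]
  exact hi

theorem proj_mem (τ : D.criticalTypes) (x : DivisibleHull G) :
    D.proj τ x ∈ hull (D.component τ) := Subtype.prop _

theorem sum_proj (x : DivisibleHull G) : ∑ τ, D.proj τ x = x := by
  have hx : x ∈ ⨆ τ : D.criticalTypes, hull (D.component τ) :=
    D.isInternal_hull.submodule_iSup_eq_top ▸ Submodule.mem_top
  induction hx using Submodule.iSup_induction' with
  | mem τ v hv =>
    simp [D.proj_of_mem hv]
  | zero => simp
  | add v w _ _ hv hw => simp only [map_add, Finset.sum_add_distrib, hv, hw]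

theorem proj_ext {x y : DivisibleHull G} (h : ∀ τ, D.proj τ x = D.proj τ y) : x = y := by
  rw [← D.sum_proj x, ← D.sum_proj y]
  exact Finset.sum_congr rfl fun τ _ => h τ

theorem mem_map_regulator_iff {x : DivisibleHull G} :
    x ∈ (regulator G).map (ι G) ↔
      ∀ τ : D.criticalTypes, D.proj τ x ∈ (D.component τ).map (ι G) := by
  constructor
  · rintro ⟨a, ha, rfl⟩ τ
    have hle : regulator G ≤ ((D.component τ).map (ι G)).comap
        ((D.proj τ).toAddMonoidHom.comp (ι G)) := by
      rw [← D.iSup_component]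
      refine iSup_le fun σ b hb => ?_
      have : D.proj τ (ι G b) = _ := D.proj_of_mem (le_purification _ hb) τ
      split_ifs at this with h
      · exact ⟨b, h ▸ hb, this.symm⟩
      · exact ⟨0, zero_mem _, (map_zero _).trans this.symm⟩
    exact hle ha
  · intro h
    rw [← D.sum_proj x]
    exact sum_mem fun τ _ => AddSubgroup.map_mono (component_le_regulator τ) (h τ)

theorem mem_map_component_iff_of_mem_hull {τ : D.criticalTypes} {v : DivisibleHull G}
    (hv : v ∈ hull (D.component τ)) :
    v ∈ (D.component τ).map (ι G) ↔ v ∈ (regulator G).map (ι G) :=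
  ⟨fun h => AddSubgroup.map_mono (component_le_regulator τ) h,
    fun h => by simpa [D.proj_of_mem hv] using mem_map_regulator_iff.1 h τ⟩

theorem mem_component_of_mem_purification {τ : D.criticalTypes} {x : G} (hx : x ∈ regulator G)
    (hxp : x ∈ purification (D.component τ)) : x ∈ D.component τ :=
  (AddSubgroup.mem_map_iff_mem DivisibleHull.coe_injective).1
    ((mem_map_component_iff_of_mem_hull hxp).2 ⟨x, hx, rfl⟩)

section MulBy

variable {τ : D.criticalTypes} {a b c : D.criticalTypes → ℚ}

theorem proj_mulBy (x : DivisibleHull G) : D.proj τ (D.mulBy c x) = c τ • D.proj τ x := by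
  simp [mulBy, D.proj_of_mem (D.proj_mem _ _)]

theorem mulBy_of_mem_hull {x : DivisibleHull G} (hx : x ∈ hull (D.component τ)) :
    D.mulBy c x = c τ • x := by
  simp [mulBy, D.proj_of_mem hx]

theorem mulBy_add (x y : DivisibleHull G) : D.mulBy c (x + y) = D.mulBy c x + D.mulBy c y := by
  simp only [mulBy, map_add, smul_add, Finset.sum_add_distrib]

theorem mulBy_one (x : DivisibleHull G) : D.mulBy 1 x = x :=
  proj_ext fun τ => by rw [proj_mulBy, Pi.one_apply, one_smul]

theorem mulBy_mul (x : DivisibleHull G) : D.mulBy (a * b) x = D.mulBy a (D.mulBy b x) :=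
  proj_ext fun τ => by rw [proj_mulBy, proj_mulBy, proj_mulBy, Pi.mul_apply, mul_smul]

end MulBy

/-- `mulBy c` as an additive map. -/
noncomputable def mulByHom (D : RegulatorDecomposition G) (c : D.criticalTypes → ℚ) :
    DivisibleHull G →+ DivisibleHull G :=
  AddMonoidHom.mk' (D.mulBy c) mulBy_add

/-- The endomorphism `f` of `G` is the restriction to `G` of the multiplication by `c`. -/
def IsMulBy (D : RegulatorDecomposition G) (c : D.criticalTypes → ℚ) (f : G →+ G) : Prop :=
  ∀ x : G, ι G (f x) = D.mulBy c (ι G x)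

namespace IsMulBy

variable {a b c : D.criticalTypes → ℚ} {f g : G →+ G}

theorem id : D.IsMulBy 1 (AddMonoidHom.id G) := fun _ => (mulBy_one _).symm

theorem comp (hf : D.IsMulBy a f) (hg : D.IsMulBy b g) : D.IsMulBy (a * b) (f.comp g) :=
  fun x => by rw [AddMonoidHom.comp_apply, hf, hg, mulBy_mul]

theorem hom_unique (hf : D.IsMulBy c f) (hg : D.IsMulBy c g) : f = g :=
  AddMonoidHom.ext fun x => DivisibleHull.coe_injective ((hf x).trans (hg x).symm)

theorem map_eq_smul_of_mem_component (hf : D.IsMulBy c f) {τ : D.criticalTypes} {x : G}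
    (hx : x ∈ D.component τ) : ι G (f x) = c τ • ι G x :=
  (hf x).trans (mulBy_of_mem_hull (le_purification _ hx))

theorem multiplier_unique (ha : D.IsMulBy a f) (hb : D.IsMulBy b f) : a = b := by
  funext τ
  obtain ⟨x, hx, hx₀⟩ := exists_mem_component_ne_zero τ
  have hx₀' : ι G x ≠ 0 := (map_ne_zero_iff (ι G) DivisibleHull.coe_injective).2 hx₀
  exact smul_left_injective ℚ hx₀' <| (ha.map_eq_smul_of_mem_component hx).symm.trans
    (hb.map_eq_smul_of_mem_component hx)

theorem comp_eq_id (hf : D.IsMulBy a f) (hg : D.IsMulBy b g) (hab : a * b = 1) :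
    f.comp g = AddMonoidHom.id G :=
  (hf.comp hg).hom_unique (hab ▸ IsMulBy.id)

theorem mul_eq_one (hf : D.IsMulBy a f) (hg : D.IsMulBy b g) (hfg : f.comp g = AddMonoidHom.id G) :
    a * b = 1 :=
  (hf.comp hg).multiplier_unique (hfg ▸ IsMulBy.id)

end IsMulBy

theorem exists_isMulBy_of_forall_mem_range {c : D.criticalTypes → ℚ}
    (hc : ∀ x : G, D.mulBy c (ι G x) ∈ (ι G).range) : ∃ f, D.IsMulBy c f := by
  let e : G ≃+ (ι G).range := (ι G).ofInjective DivisibleHull.coe_injective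
  refine ⟨e.symm.toAddMonoidHom.comp (((D.mulByHom c).comp (ι G)).codRestrict _ hc), fun x => ?_⟩
  exact congrArg Subtype.val (e.apply_symm_apply _)

section EndomorphismsAreMultiplications

theorem IsRigid.hasType_map_component (hD : D.IsRigid) (τ : D.criticalTypes) :
    HasType ((D.component τ).map (ι G)) τ :=
  (hD.hasType_component τ).of_addEquiv
    ((D.component τ).equivMapOfInjective (ι G) DivisibleHull.coe_injective)

theorem IsRigid.proj_map_eq_zero (hD : D.IsRigid) (f : G →+ G) {σ τ : D.criticalTypes}
    (hστ : σ ≠ τ) {x : G} (hx : x ∈ D.component τ) : D.proj σ (ι G (f x)) = 0 := by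
  obtain ⟨k, hk, hkG⟩ := exists_nsmul_mem_regulator G
  let φ : D.component τ →+ (D.component σ).map (ι G) :=
    AddMonoidHom.codRestrict
      ((D.proj σ).toAddMonoidHom.comp ((ι G).comp ((k • f).comp (D.component τ).subtype))) _
      fun y => mem_map_regulator_iff.1 ⟨_, hkG (f y), rfl⟩ σ
  have hφ : φ = 0 := by
    by_contra hne
    have hle := (hD.hasType_component τ).le_of_hom_ne_zero (hD.hasType_map_component σ) hne
    exact (hD.1 σ σ.2 τ τ.2 (Subtype.coe_injective.ne hστ)).2 hle
  have hkx : k • D.proj σ (ι G (f x)) = 0 := by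
    rw [← map_nsmul, ← map_nsmul]
    exact congrArg Subtype.val (DFunLike.congr_fun hφ ⟨x, hx⟩)
  exact (smul_eq_zero_iff_right hk.ne').1 hkx

theorem IsRigid.map_mem_hull_component (hD : D.IsRigid) (f : G →+ G) {τ : D.criticalTypes} {x : G}
    (hx : x ∈ D.component τ) : ι G (f x) ∈ hull (D.component τ) := by
  rw [← D.sum_proj (ι G (f x)), Finset.sum_eq_single τ
    (fun σ _ hστ => hD.proj_map_eq_zero f hστ hx) (fun h => absurd (Finset.mem_univ τ) h)]
  exact D.proj_mem τ _

theorem IsRigid.hom_ext (hD : D.IsRigid) {V : Type*} [AddCommGroup V] [IsAddTorsionFree V]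
    {f g : G →+ V} (h : ∀ τ : D.criticalTypes, ∃ x ∈ D.component τ, x ≠ 0 ∧ f x = g x) :
    f = g := by
  obtain ⟨k, hk, hkG⟩ := exists_nsmul_mem_regulator G
  have hle : regulator G ≤ f.eqLocus g := by
    rw [← D.iSup_component]
    refine iSup_le fun τ y hy => ?_
    obtain ⟨x, hx, hx₀, hfg⟩ := h τ
    have := (hD.hasType_component τ).1.hom_ext (e := ⟨x, hx⟩)
      (f := f.comp (D.component τ).subtype) (g := g.comp (D.component τ).subtype)
      (by simpa using hx₀) hfg
    exact DFunLike.congr_fun this ⟨y, hy⟩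
  ext x
  have hkx : f (k • x) = g (k • x) := hle (hkG x)
  exact nsmul_right_injective hk.ne' (by simpa only [map_nsmul] using hkx)

theorem IsRigid.exists_isMulBy (hD : D.IsRigid) (f : G →+ G) : ∃ c, D.IsMulBy c f := by
  choose e he he₀ using exists_mem_component_ne_zero (D := D)
  have hc : ∀ τ, ∃ c : ℚ, c • ι G (e τ) = ι G (f (e τ)) := fun τ => by
    have := hD.map_mem_hull_component f (he τ)
    rwa [(hD.hasType_component τ).1.hull_eq_span_singleton (he τ) (he₀ τ),
      Submodule.mem_span_singleton] at this
  choose c hc using hc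
  have : (ι G).comp f = (D.mulByHom c).comp (ι G) :=
    hD.hom_ext fun τ => ⟨e τ, he τ, he₀ τ,
      (hc τ).symm.trans (mulBy_of_mem_hull (le_purification _ (he τ))).symm⟩
  exact ⟨c, DFunLike.congr_fun this⟩

end EndomorphismsAreMultiplications

section Purity

theorem IsRigid.exists_le_purification_component (hD : D.IsRigid) {B : AddSubgroup G}
    (hB : IsRankOne B) {l : ℕ} (hl : l ≠ 0) {θ : G →+ B} (hθ : ∀ b : B, θ b = l • b) :
    ∃ τ : D.criticalTypes, B ≤ purification (D.component τ) := by
  obtain ⟨c, hc⟩ := hD.exists_isMulBy (B.subtype.comp θ)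
  obtain ⟨b, hb⟩ := hB.exists_ne_zero
  have hb' : ι G b ≠ 0 :=
    (map_ne_zero_iff (ι G) DivisibleHull.coe_injective).2 (by simpa using hb)
  obtain ⟨τ, hτ⟩ : ∃ τ, D.proj τ (ι G b) ≠ 0 := by
    by_contra! h
    exact hb' (proj_ext fun τ => by rw [h τ, map_zero])
  have hcτ : c τ = l := by
    refine smul_left_injective ℚ hτ ?_
    have : ι G (θ b) = D.mulBy c (ι G b) := hc b
    rw [hθ, AddSubgroup.coe_nsmul, coe_nsmul] at this
    simpa only [proj_mulBy, map_smul] using (congrArg (D.proj τ) this).symm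
  obtain ⟨e, he, he₀⟩ := exists_mem_component_ne_zero τ
  have hθe : (θ e : G) = l • e := DivisibleHull.coe_injective <| by
    have := hc.map_eq_smul_of_mem_component he
    rwa [hcτ, ← coe_nsmul] at this
  refine ⟨τ, fun x hx => ?_⟩
  have : ι G x ∈ Submodule.span ℚ {ι G (l • e)} := by
    rw [← hB.hull_eq_span_singleton (hθe ▸ (θ e).2) (smul_ne_zero hl he₀)]
    exact le_purification B hx
  exact (Submodule.span_singleton_le_iff_mem _ (hull (D.component τ))).2
    (le_purification _ ((D.component τ).nsmul_mem he l)) this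

theorem IsRigid.le_iSup_purification (hD : D.IsRigid) {C : AddSubgroup G}
    (hC : IsCompletelyDecomposable C) [C.FiniteIndex] :
    C ≤ ⨆ τ : D.criticalTypes, purification (D.component τ) := by
  obtain ⟨n, B, hB⟩ := hC
  rw [← hB.iSup_eq]
  refine iSup_le fun i => ?_
  obtain ⟨θ, hθ⟩ := exists_hom_eq_nsmul_of_disjoint (l := C.index) (hB.indep i) fun g => by
    rw [← iSup_split_single, hB.iSup_eq]
    exact C.nsmul_index_mem g
  obtain ⟨τ, hτ⟩ :=
    hD.exists_le_purification_component (hB.rankOne i) AddSubgroup.FiniteIndex.index_ne_zero hθ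
  exact hτ.trans (le_iSup (fun τ : D.criticalTypes => purification (D.component τ)) τ)

theorem IsRigid.isRankOne_purification (hD : D.IsRigid) (τ : D.criticalTypes) :
    IsRankOne (purification (D.component τ)) := by
  obtain ⟨k, hk, hkG⟩ := exists_nsmul_mem_regulator G
  let φ : purification (D.component τ) →+ D.component τ :=
    ((nsmulAddMonoidHom k).comp (AddSubgroup.subtype _)).codRestrict _ fun x =>
      mem_component_of_mem_purification (hkG x) (AddSubgroup.nsmul_mem _ x.2 k)
  refine (hD.hasType_component τ).1.of_injective (g := φ)
    (AddSubgroup.inclusion_injective (le_purification (D.component τ))) fun x y hxy => ?_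
  exact Subtype.ext (nsmul_right_injective hk.ne' (congrArg Subtype.val hxy))

theorem IsRigid.purification_component (hD : D.IsRigid) (τ : D.criticalTypes) :
    purification (D.component τ) = D.component τ := by
  have hcd : IsCompletelyDecomposable (⨆ σ : D.criticalTypes, purification (D.component σ)) :=
    isCompletelyDecomposable_iSup hD.isRankOne_purification
      (iSupIndep_purification (D.iSupIndep_component.comp Subtype.val_injective))
  have hle : ⨆ σ : D.criticalTypes, purification (D.component σ) ≤ regulator G :=
    le_sInf fun A hA => by
      have := hA.2.1
      exact (hA.eq_of_le hcd (hD.le_iSup_purification hA.1)).ge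
  refine le_antisymm (fun x hx => mem_component_of_mem_purification (hle ?_) hx)
    (le_purification _)
  exact le_iSup (fun σ : D.criticalTypes => purification (D.component σ)) τ hx

theorem IsMulBy.mem_multiplierSubring {c : D.criticalTypes → ℚ} {f : G →+ G} (hD : D.IsRigid)
    (hf : D.IsMulBy c f) (τ : D.criticalTypes) :
    c τ ∈ multiplierSubring ((D.component τ).map (ι G)) := by
  rintro _ ⟨x, hx, rfl⟩
  rw [← hf.map_eq_smul_of_mem_component hx]
  exact ⟨f x, hD.purification_component τ ▸ hD.map_mem_hull_component f hx, rfl⟩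

end Purity

section KRing

theorem m_eq_addOrderOf (d : G) (τ : D.criticalTypes) :
    D.m d τ = addOrderOf (D.proj τ (ι G d) : DivisibleHull G ⧸ (D.component τ).map (ι G)) := by
  refine addOrderOf_eq_addOrderOf_iff.2 fun n => ?_
  rw [← QuotientAddGroup.mk_nsmul, ← QuotientAddGroup.mk_nsmul, QuotientAddGroup.eq_zero_iff,
    QuotientAddGroup.eq_zero_iff]
  exact (mem_map_component_iff_of_mem_hull (nsmul_mem (D.proj_mem τ _) n)).symm

variable {R : D.criticalTypes → Subring ℚ} {d : G}

theorem IsRigid.multiplierSubring_component (hD : D.IsRigid) (hR : ∀ τ, HasType (R τ) τ)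
    (τ : D.criticalTypes) : multiplierSubring ((D.component τ).map (ι G)) = R τ :=
  (hD.hasType_map_component τ).multiplierSubring_eq (hR τ)

theorem IsRigid.mem_kRing_iff_mulBy_sub_mem (hD : D.IsRigid) (hR : ∀ τ, HasType (R τ) τ)
    {c : ∀ τ, R τ} :
    c ∈ kRing R (D.m d) ↔ ∃ γ : ℤ,
      D.mulBy (fun τ => (c τ : ℚ)) (ι G d) - γ • ι G d ∈ (regulator G).map (ι G) := by
  refine mem_kRing_iff.trans (exists_congr fun γ => ?_)
  refine (forall_congr' fun τ => ?_).trans mem_map_regulator_iff.symm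
  have hsub : (c τ - γ : ℚ) ∈ multiplierSubring ((D.component τ).map (ι G)) :=
    sub_mem (by rw [hD.multiplierSubring_component hR τ]; exact (c τ).2) (intCast_mem _ γ)
  rw [map_sub, proj_mulBy, map_zsmul, ← Int.cast_smul_eq_zsmul ℚ, ← sub_smul,
    smul_mem_iff_exists_eq_addOrderOf_mul hsub, hD.multiplierSubring_component hR τ,
    m_eq_addOrderOf]

theorem mulBy_mem_map_regulator {c : D.criticalTypes → ℚ}
    (hc : ∀ τ : D.criticalTypes, c τ ∈ multiplierSubring ((D.component τ).map (ι G)))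
    {x : DivisibleHull G} (hx : x ∈ (regulator G).map (ι G)) :
    D.mulBy c x ∈ (regulator G).map (ι G) :=
  mem_map_regulator_iff.2 fun τ =>
    proj_mulBy (D := D) x ▸ hc τ _ (mem_map_regulator_iff.1 hx τ)

theorem IsRigid.exists_mem_kRing (hD : D.IsRigid) (hR : ∀ τ, HasType (R τ) τ)
    (hd : AddSubgroup.zmultiples (d : G ⧸ regulator G) = ⊤) (f : G →+ G) :
    ∃ c ∈ kRing R (D.m d), D.IsMulBy (fun τ => (c τ : ℚ)) f := by
  obtain ⟨c, hc⟩ := hD.exists_isMulBy f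
  have hcR : ∀ τ, c τ ∈ R τ := fun τ =>
    hD.multiplierSubring_component hR τ ▸ hc.mem_multiplierSubring hD τ
  obtain ⟨γ, hγ⟩ := exists_sub_zsmul_mem hd (f d)
  refine ⟨fun τ => ⟨c τ, hcR τ⟩,
    (hD.mem_kRing_iff_mulBy_sub_mem hR).2 ⟨γ, f d - γ • d, hγ, ?_⟩, hc⟩
  rw [map_sub, map_zsmul, hc d]

theorem IsRigid.exists_isMulBy_of_mem_kRing (hD : D.IsRigid) (hR : ∀ τ, HasType (R τ) τ)
    (hd : AddSubgroup.zmultiples (d : G ⧸ regulator G) = ⊤) {c : ∀ τ, R τ}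
    (hc : c ∈ kRing R (D.m d)) : ∃ f, D.IsMulBy (fun τ => (c τ : ℚ)) f := by
  let M : AddSubgroup G := ((ι G).range).comap ((D.mulByHom fun τ => (c τ : ℚ)).comp (ι G))
  have hdM : d ∈ M := by
    obtain ⟨γ, a, -, ha⟩ := (hD.mem_kRing_iff_mulBy_sub_mem hR).1 hc
    refine ⟨a + γ • d, ?_⟩
    rw [map_add, map_zsmul, ha]
    exact sub_add_cancel _ _
  have hregM : regulator G ≤ M := fun b hb =>
    AddSubgroup.map_le_range _ _ (mulBy_mem_map_regulator
      (fun τ => by rw [hD.multiplierSubring_component hR τ]; exact (c τ).2) ⟨b, hb, rfl⟩)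
  refine exists_isMulBy_of_forall_mem_range fun g => (?_ : g ∈ M)
  obtain ⟨n, hn⟩ := exists_sub_zsmul_mem hd g
  exact sub_add_cancel g (n • d) ▸ M.add_mem (hregM hn) (M.zsmul_mem hdM n)

theorem IsRigid.exists_unit_kRing (hD : D.IsRigid) (hR : ∀ τ, HasType (R τ) τ)
    (hd : AddSubgroup.zmultiples (d : G ⧸ regulator G) = ⊤) (f : G ≃+ G) :
    ∃ c : (kRing R (D.m d))ˣ,
      D.IsMulBy (fun τ => ((c : kRing R (D.m d)).1 τ : ℚ)) f.toAddMonoidHom := by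
  obtain ⟨a, ha, hfa⟩ := hD.exists_mem_kRing hR hd f.toAddMonoidHom
  obtain ⟨b, hb, hfb⟩ := hD.exists_mem_kRing hR hd f.symm.toAddMonoidHom
  have hab : a * b = 1 := by
    have := hfa.mul_eq_one hfb (AddMonoidHom.ext f.apply_symm_apply)
    exact funext fun τ => Subtype.ext (congrFun this τ)
  exact ⟨Units.mkOfMulEqOne ⟨a, ha⟩ ⟨b, hb⟩ (Subtype.ext hab), hfa⟩

theorem IsRigid.exists_addEquiv_of_unit_kRing (hD : D.IsRigid) (hR : ∀ τ, HasType (R τ) τ)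
    (hd : AddSubgroup.zmultiples (d : G ⧸ regulator G) = ⊤) (c : (kRing R (D.m d))ˣ) :
    ∃ f : G ≃+ G, D.IsMulBy (fun τ => ((c : kRing R (D.m d)).1 τ : ℚ)) f.toAddMonoidHom := by
  obtain ⟨f, hf⟩ := hD.exists_isMulBy_of_mem_kRing hR hd c.1.2
  obtain ⟨g, hg⟩ := hD.exists_isMulBy_of_mem_kRing hR hd c⁻¹.1.2
  have hcoe : ∀ {a b : kRing R (D.m d)}, a * b = 1 →
      (fun τ => (a.1 τ : ℚ)) * (fun τ => (b.1 τ : ℚ)) = 1 := fun h =>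
    funext fun τ => congrArg (fun a : kRing R (D.m d) => (a.1 τ : ℚ)) h
  exact ⟨f.toAddEquiv g (hg.comp_eq_id hf (hcoe c.inv_mul))
    (hf.comp_eq_id hg (hcoe c.mul_inv)), hf⟩

end KRing

end RegulatorDecomposition

end ACD

/-- Let `G` be a rigid almost completely decomposable group of ring type with cyclic regulator
quotient `G / Reg G`, generated by the coset of `d`. The endomorphisms (automorphisms) of `G` are
exactly the multiplications by elements of the ring `K_G` (by units of `K_G`). -/
theorem lemma2p3 {G : Type*} [AddCommGroup G] [ACD.IsAlmostCompletelyDecomposable G]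
    (D : ACD.RegulatorDecomposition G) (hrigid : D.IsRigid) (hring : D.IsOfRingType)
    (d : G) (hd : AddSubgroup.zmultiples (d : G ⧸ ACD.regulator G) = ⊤)
    (R : D.criticalTypes → Subring ℚ) (hR : ∀ τ, ACD.HasType (R τ) τ) :
    (∀ f : G →+ G, ∃ c ∈ ACD.kRing R (D.m d), ∀ x : G,
      (f x : DivisibleHull G) = D.mulBy (fun τ => (c τ : ℚ)) x) ∧
    (∀ f : G ≃+ G, ∃ c : (ACD.kRing R (D.m d))ˣ, ∀ x : G,
      (f x : DivisibleHull G) = D.mulBy (fun τ => ((c : ACD.kRing R (D.m d)).1 τ : ℚ)) x) ∧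
    (∀ c ∈ ACD.kRing R (D.m d), ∃ f : G →+ G, ∀ x : G,
      (f x : DivisibleHull G) = D.mulBy (fun τ => (c τ : ℚ)) x) ∧
    (∀ c : (ACD.kRing R (D.m d))ˣ, ∃ f : G ≃+ G, ∀ x : G,
      (f x : DivisibleHull G) = D.mulBy (fun τ => ((c : ACD.kRing R (D.m d)).1 τ : ℚ)) x) :=
  ⟨hrigid.exists_mem_kRing hR hd, hrigid.exists_unit_kRing hR hd,
    fun _ hc => hrigid.exists_isMulBy_of_mem_kRing hR hd hc,
    hrigid.exists_addEquiv_of_unit_kRing hR hd⟩
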